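/- For a permutation $\sigma=\sigma_1\cdots\sigma_n\in\mathcal S_n$ let $\mathrm{inv}(\sigma)=\{(i,j): i<j,\ \sigma_i>\sigma_j\}$, and let $I_n(q)=\prod_{j=1}^n\sum_{i=0}^{j-1}q^i$. For $q>0$, a random permutation $\Sigma_n$ of $[n]$ is Mallows$(q)$ if $P\{\Sigma_n=\sigma\}=q^{|\mathrm{inv}(\sigma)|}/I_n(q)$ for all $\sigma\in\mathcal S_n$. For a word $w$ of $k$ distinct integers, $\mathrm{red}(w)\in\mathcal S_k$ denotes the permutation that is order-isomorphic to $w$. For $\tau\in\mathcal S_m$ and $1\le s\le m-1$ let $\overline L_s(\tau)$ be the set of $\rho\in\mathcal S_{2m-s}$ with $\mathrm{red}(\rho_1\cdots\rho_m)=\mathrm{red}(\rho_{m-s+1}\cdots\rho_{2m-s})=\tau$. For random variables $X,Y$ with values in $\{0,1,2,\dots\}$ let $d_{TV}(\mathcal L(X),\mathcal L(Y))=\frac12\sum_{k\ge0}|P(X=k)-P(Y=k)|$. **Theorem.** Let $q>0$, $2\le m\le n$, $\tau\in\mathcal S_m$, let $\Sigma_n$ be Mallows$(q)$, and let $$W=\sum_{i=1}^{n-m+1}\mathbb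 I\big(\mathrm{red}(\Sigma_n(i)\Sigma_n(i+1)\cdots\Sigma_n(i+m-1))=\tau\big)$$ be the number of consecutive occurrences of $\tau$ in $\Sigma_n$. Let $Y$ be a Poisson random variable with mean $\lambda=\mathbb E W$. Then $$\lambda=(n-m+1)\frac{q^{|\mathrm{inv}(\tau)|}}{I_m(q)}\qquad\text{and}\qquad d_{TV}(\mathcal L(W),\mathcal L(Y))\le 2(b_1+b_2),$$ where $$b_1=\frac{n_1\,q^{2|\mathrm{inv}(\tau)|}}{I_m(q)^2},\qquad b_2=\sum_{s=1}^{m-1}\max(n-2m+s+1,\,0)\sum_{\rho\in\overline L_s(\tau)}\frac{q^{|\mathrm{inv}(\rho)|}}{I_{2m-s}(q)},$$ and $n_1=2mn-3m^2+m$ if $n\ge 2m-1$, while $n_1=(n-m+1)^2$ if $m\le n<2m-1$. -/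

import Mathlib

open MeasureTheory ProbabilityTheory

/-- The set of inversions of a permutation: pairs `(i, j)` with `i < j` and `σ j < σ i`. -/
def inversions {n : ℕ} (σ : Equiv.Perm (Fin n)) : Finset (Fin n × Fin n) :=
  Finset.univ.filter fun p => p.1 < p.2 ∧ σ p.2 < σ p.1

/-- The inversion polynomial `I_n(q) = ∏_{j=1}^n ∑_{i=0}^{j-1} q^i`. -/
def inversionPoly (n : ℕ) (q : ℝ) : ℝ :=
  ∏ j ∈ Finset.Icc 1 n, ∑ i ∈ Finset.range j, q ^ i

/-- The weight `q^{|inv σ|} / I_n(q)` of a permutation `σ` of `n` letters. -/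
noncomputable def mallowsWeight {n : ℕ} (q : ℝ) (σ : Equiv.Perm (Fin n)) : ℝ :=
  q ^ (inversions σ).card / inversionPoly n q

/-- `S` is a random permutation of `n` letters with the Mallows(`q`) distribution under `P`. -/
def IsMallows {Ω : Type*} [MeasurableSpace Ω] {n : ℕ} (q : ℝ)
    (S : Ω → Equiv.Perm (Fin n)) (P : Measure Ω) : Prop :=
  ∀ σ : Equiv.Perm (Fin n), MeasurableSet (S ⁻¹' {σ}) ∧
    P (S ⁻¹' {σ}) = ENNReal.ofReal (mallowsWeight q σ)

/-- The reduction `red(w)` of a word `w = w_1 ⋯ w_k` with distinct letters. As `Tuple.sort w i` is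
the position of the `i`-th smallest letter, its inverse sends each position to the rank of its
letter. -/
def red {k n : ℕ} (w : Fin k → Fin n) : Equiv.Perm (Fin k) :=
  (Tuple.sort w)⁻¹

/-- `σ` contains `τ` at the `m` consecutive positions starting at `i` (positions are counted from
`0`): these positions exist, and `red(σ_i σ_{i+1} ⋯ σ_{i+m-1}) = τ`. -/
def OccursAt {m n : ℕ} (τ : Equiv.Perm (Fin m)) (σ : Equiv.Perm (Fin n)) (i : ℕ) : Prop :=
  ∃ h : i + m ≤ n, red (fun k : Fin m => σ ⟨i + k, by omega⟩) = τ

open Classical in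
/-- The number of consecutive occurrences of `τ` in `σ`: the sum of the indicators `X_α` over all
sets `α = {i, …, i+m-1}` of `m` consecutive positions (where `m ≤ n`). -/
noncomputable def consecutiveOccurrences {m n : ℕ} (τ : Equiv.Perm (Fin m))
    (σ : Equiv.Perm (Fin n)) : ℕ :=
  ∑ i ∈ Finset.range (n - m + 1), if OccursAt τ σ i then 1 else 0

open Classical in
/-- The sequential overlaps of size `s` of `τ`: the permutations `ρ` of `2m-s` letters whose first
`m` and last `m` letters both reduce to `τ`. -/
noncomputable def sequentialOverlaps {m : ℕ} (s : ℕ) (τ : Equiv.Perm (Fin m)) :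
    Finset (Equiv.Perm (Fin (2 * m - s))) :=
  Finset.univ.filter fun ρ => OccursAt τ ρ 0 ∧ OccursAt τ ρ (m - s)

/-- Total variation distance between two distributions on `ℕ`. -/
noncomputable def dTV (μ ν : Measure ℕ) : ℝ :=
  1 / 2 * ∑' k : ℕ, |μ.real {k} - ν.real {k}|

/-- The factor `n_1` in `b_1`. If `n < 2m-1`, then any two of the `n-m+1` windows overlap, and
`n_1` is the number of ordered pairs of windows. -/
noncomputable def nOne (n m : ℕ) : ℝ :=
  if 2 * m - 1 ≤ n then 2 * m * n - 3 * (m : ℝ) ^ 2 + m else ((n : ℝ) - m + 1) ^ 2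

/-- The term `b_1 = n_1 q^{2|inv τ|} / I_m(q)^2`. -/
noncomputable def bOne (n : ℕ) {m : ℕ} (q : ℝ) (τ : Equiv.Perm (Fin m)) : ℝ :=
  nOne n m * q ^ (2 * (inversions τ).card) / inversionPoly m q ^ 2

/-- The term `b_2`: for each `s = 1, …, m-1`, the number `max(n-2m+s+1, 0)` of sets of `2m-s`
consecutive positions, times the sum of `q^{|inv ρ|} / I_{2m-s}(q)` over the overlaps of
size `s`. -/
noncomputable def bTwo (n : ℕ) {m : ℕ} (q : ℝ) (τ : Equiv.Perm (Fin m)) : ℝ :=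
  ∑ s ∈ Finset.Icc 1 (m - 1), max ((n : ℝ) - 2 * m + s + 1) 0 *
    ∑ ρ ∈ sequentialOverlaps s τ, q ^ (inversions ρ).card / inversionPoly (2 * m - s) q

/-! The proof is the Chen–Stein method with dependency neighbourhoods. Permuting the positions
inside a window changes only the inversions inside it. So the Mallows weight of `σ` factors into `q
^ inv` of the window's pattern and a part that such permutations fix. Hence the pattern is itself
Mallows distributed and independent of everything that ignores the order inside the window
(`sum_mallows_windowPattern`), in particular of occurrences in disjoint windows. This gives the
mean. It also evaluates the overlap terms, because two windows sharing `s` positions fill one window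
of length `2m-s`. Solutions of the Stein equation for test functions into `[0, 1]` have increments
at most 1 in absolute value, so `chenStein_finite` bounds the error by sums over ordered pairs of
meeting windows. Each unordered pair of distinct windows counts twice, which gives `2 * bTwo`
exactly; the diagonal joins the product terms, which `2 * bOne` bounds. -/

/-! ### Poisson weights and the Stein equation -/

/-- The weight `e^{-r} r^k / k!` of the Poisson distribution. -/
noncomputable def poissonWeight (r : ℝ) (k : ℕ) : ℝ := Real.exp (-r) * r ^ k / k.factorial

lemma poissonWeight_pos {r : ℝ} (hr : 0 < r) (k : ℕ) : 0 < poissonWeight r k := by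
  unfold poissonWeight; positivity

lemma succ_mul_poissonWeight (r : ℝ) (k : ℕ) :
    ((k : ℝ) + 1) * poissonWeight r (k + 1) = r * poissonWeight r k := by
  unfold poissonWeight
  rw [Nat.factorial_succ]
  push_cast
  field_simp
  ring

lemma hasSum_poissonWeight {r : ℝ} (hr : 0 < r) : HasSum (poissonWeight r) 1 := by
  have := hasSum_one_poissonMeasure r.toNNReal
  rwa [Real.coe_toNNReal r hr.le] at this

/-- The Poisson mean of a function on `ℕ`. -/
noncomputable def poissonMean (r : ℝ) (h : ℕ → ℝ) : ℝ := ∑' k, h k * poissonWeight r k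

lemma summable_mul_poissonWeight {r : ℝ} (hr : 0 < r) {h : ℕ → ℝ} (h0 : ∀ k, 0 ≤ h k)
    (h1 : ∀ k, h k ≤ 1) : Summable fun k => h k * poissonWeight r k :=
  (hasSum_poissonWeight hr).summable.of_nonneg_of_le
    (fun k => mul_nonneg (h0 k) (poissonWeight_pos hr k).le)
    (fun k => mul_le_of_le_one_left (poissonWeight_pos hr k).le (h1 k))

/-- The solution `f` of the Stein equation `r f(k+1) - k f(k) = h(k) - E h(Poisson r)`. -/
noncomputable def steinSolution (r : ℝ) (h : ℕ → ℝ) : ℕ → ℝ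
  -- An arbitrary value: the Stein equation multiplies it by `0`.
  | 0 => 0
  | k + 1 => (∑ j ∈ Finset.range (k + 1), h j * poissonWeight r j -
      poissonMean r h * ∑ j ∈ Finset.range (k + 1), poissonWeight r j) / (r * poissonWeight r k)

lemma steinSolution_equation {r : ℝ} (hr : 0 < r) (h : ℕ → ℝ) (k : ℕ) :
    r * steinSolution r h (k + 1) - k * steinSolution r h k = h k - poissonMean r h := by
  cases k with
  | zero =>
    have := poissonWeight_pos hr 0
    simp only [steinSolution, Finset.sum_range_one, zero_add]
    field_simp
    simp
  | succ k =>
    have h1 := poissonWeight_pos hr k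
    have h2 := poissonWeight_pos hr (k + 1)
    have h3 := succ_mul_poissonWeight r k
    simp only [steinSolution]
    rw [← h3, Finset.sum_range_succ _ (k + 1), Finset.sum_range_succ _ (k + 1)]
    push_cast
    field_simp
    ring

/-- The Poisson tail is log-concave. -/
lemma poissonWeight_tail_ratio {r : ℝ} (hr : 0 < r) (k : ℕ) :
    (1 - ∑ j ∈ Finset.range (k + 2), poissonWeight r j) * poissonWeight r k ≤
      (1 - ∑ j ∈ Finset.range (k + 1), poissonWeight r j) * poissonWeight r (k + 1) := by
  have hs := hasSum_poissonWeight hr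
  have h2 := ((hasSum_nat_add_iff' (k + 2)).2 hs).mul_right (poissonWeight r k)
  have h1 := ((hasSum_nat_add_iff' (k + 1)).2 hs).mul_right (poissonWeight r (k + 1))
  -- The comparison holds term by term, since the ratio of consecutive weights, `r / (j+1)`,
  -- decreases in `j`.
  refine hasSum_le (fun i => ?_) h2 h1
  have e1 := succ_mul_poissonWeight r k
  have e2 := succ_mul_poissonWeight r (i + (k + 1))
  have p1 := poissonWeight_pos hr (i + (k + 1) + 1)
  have p2 := poissonWeight_pos hr (k + 1)
  have e3 : i + (k + 2) = i + (k + 1) + 1 := by ring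
  rw [e3]
  refine le_of_mul_le_mul_left ?_ hr
  calc r * (poissonWeight r (i + (k + 1) + 1) * poissonWeight r k)
      = ((k : ℝ) + 1) * (poissonWeight r (k + 1) * poissonWeight r (i + (k + 1) + 1)) := by
        linear_combination (-poissonWeight r (i + (k + 1) + 1)) * e1
    _ ≤ ((i + (k + 1) : ℕ) + 1 : ℝ) *
          (poissonWeight r (k + 1) * poissonWeight r (i + (k + 1) + 1)) := by
        gcongr
        have : (0 : ℝ) ≤ i := by positivity
        linarith
    _ = r * (poissonWeight r (i + (k + 1)) * poissonWeight r (k + 1)) := by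
        linear_combination poissonWeight r (k + 1) * e2

/-- The Poisson distribution function is log-concave. -/
lemma poissonWeight_cdf_ratio {r : ℝ} (hr : 0 < r) (k : ℕ) :
    (∑ j ∈ Finset.range (k + 1), poissonWeight r j) * poissonWeight r (k + 1) ≤
      (∑ j ∈ Finset.range (k + 2), poissonWeight r j) * poissonWeight r k := by
  rw [Finset.sum_range_succ' _ (k + 1), add_mul, Finset.sum_mul, Finset.sum_mul]
  have p0 := mul_pos (poissonWeight_pos hr 0) (poissonWeight_pos hr k)
  refine le_add_of_le_of_nonneg (Finset.sum_le_sum fun i hi => ?_) p0.le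
  have e1 := succ_mul_poissonWeight r k
  have e2 := succ_mul_poissonWeight r i
  have p1 := poissonWeight_pos hr (i + 1)
  have p2 := poissonWeight_pos hr (k + 1)
  have hik : (i : ℝ) ≤ k := by exact_mod_cast Nat.lt_succ_iff.1 (Finset.mem_range.1 hi)
  refine le_of_mul_le_mul_left ?_ hr
  calc r * (poissonWeight r i * poissonWeight r (k + 1))
      = ((i : ℝ) + 1) * (poissonWeight r (k + 1) * poissonWeight r (i + 1)) := by
        linear_combination (-poissonWeight r (k + 1)) * e2
    _ ≤ ((k : ℝ) + 1) * (poissonWeight r (k + 1) * poissonWeight r (i + 1)) := by gcongr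
    _ = r * (poissonWeight r (i + 1) * poissonWeight r k) := by
        linear_combination poissonWeight r (i + 1) * e1

/-- `P(Z > k+1)/r + P(Z ≤ k)/(k+1) ≤ 1` for a Poisson variable `Z`. -/
lemma poissonWeight_tail_add_cdf_le {r : ℝ} (hr : 0 < r) (k : ℕ) :
    (1 - ∑ j ∈ Finset.range (k + 2), poissonWeight r j) / r +
      (∑ j ∈ Finset.range (k + 1), poissonWeight r j) / (k + 1) ≤ 1 := by
  -- As `w j / (j+1) = w (j+1) / r`, the second summand is at most `P(1 ≤ Z ≤ k+1) / r`. The total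
  -- is then at most `P(Z ≥ 1) / r = (1 - e^{-r}) / r ≤ 1`.
  have key : (∑ j ∈ Finset.range (k + 1), poissonWeight r j) / (k + 1) ≤
      (∑ j ∈ Finset.range (k + 1), poissonWeight r (j + 1)) / r := by
    rw [Finset.sum_div, Finset.sum_div]
    refine Finset.sum_le_sum fun j hj => ?_
    have e := succ_mul_poissonWeight r j
    have p := poissonWeight_pos hr (j + 1)
    have hjk : (j : ℝ) ≤ k := by exact_mod_cast Nat.lt_succ_iff.1 (Finset.mem_range.1 hj)
    rw [div_le_div_iff₀ (by positivity) hr, mul_comm, ← e, mul_comm]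
    gcongr
  have hexp : 1 - poissonWeight r 0 ≤ r := by
    have := Real.add_one_le_exp (-r)
    simp [poissonWeight]
    linarith
  rw [Finset.sum_range_succ' _ (k + 1)]
  have e : (1 - (∑ j ∈ Finset.range (k + 1), poissonWeight r (j + 1) + poissonWeight r 0)) / r
      = (1 - poissonWeight r 0) / r
        - (∑ j ∈ Finset.range (k + 1), poissonWeight r (j + 1)) / r := by ring
  rw [e]
  have : (1 - poissonWeight r 0) / r ≤ 1 := (div_le_one hr).2 hexp
  linarith

/-- The increment is linear in `h`. By the two log-concavity lemmas every value except `h (k+1)`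
enters with a nonpositive coefficient, and the coefficient of `h (k+1)` is at most 1. -/
lemma steinSolution_succ_sub_le {r : ℝ} (hr : 0 < r) {h : ℕ → ℝ} (h0 : ∀ k, 0 ≤ h k)
    (h1 : ∀ k, h k ≤ 1) (k : ℕ) :
    steinSolution r h (k + 2) - steinSolution r h (k + 1) ≤ 1 := by
  have hsum := summable_mul_poissonWeight hr h0 h1
  have hb : ∑ j ∈ Finset.range (k + 2), h j * poissonWeight r j ≤ poissonMean r h :=
    hsum.sum_le_tsum _ fun j _ => mul_nonneg (h0 j) (poissonWeight_pos hr j).le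
  have ha : 0 ≤ ∑ j ∈ Finset.range (k + 1), h j * poissonWeight r j :=
    Finset.sum_nonneg fun j _ => mul_nonneg (h0 j) (poissonWeight_pos hr j).le
  have hT := poissonWeight_tail_ratio hr k
  have hU := poissonWeight_cdf_ratio hr k
  have hTU := poissonWeight_tail_add_cdf_le hr k
  have hT0 : 0 ≤ 1 - ∑ j ∈ Finset.range (k + 2), poissonWeight r j := by
    have := (hasSum_poissonWeight hr).summable.sum_le_tsum (Finset.range (k + 2))
      fun j _ => (poissonWeight_pos hr j).le
    rw [(hasSum_poissonWeight hr).tsum_eq] at this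
    linarith
  have hU0 : 0 ≤ ∑ j ∈ Finset.range (k + 1), poissonWeight r j :=
    Finset.sum_nonneg fun j _ => (poissonWeight_pos hr j).le
  have e := succ_mul_poissonWeight r k
  have p0 := poissonWeight_pos hr k
  have p1 := poissonWeight_pos hr (k + 1)
  have hk0 := h0 (k + 1)
  have hk1 := h1 (k + 1)
  simp only [steinSolution]
  rw [Finset.sum_range_succ _ (k + 1)] at hb hT hU hTU hT0
  rw [Finset.sum_range_succ _ (k + 1)]
  rw [Finset.sum_range_succ _ (k + 1)]
  generalize ∑ j ∈ Finset.range (k + 1), h j * poissonWeight r j = a at *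
  generalize ∑ j ∈ Finset.range (k + 1), poissonWeight r j = U at *
  generalize poissonMean r h = H at *
  generalize poissonWeight r k = x at *
  generalize poissonWeight r (k + 1) = y at *
  generalize h (k + 1) = t at *
  have hx : x = (k + 1) * y / r := by field_simp; linarith
  -- Here `a` collects the `h`-mass on `0, …, k` and `H - (a + t * y)` the mass beyond `k+1`.
  have hsplit : (a + t * y - H * (U + y)) / (r * y) - (a - H * U) / (r * x)
      = a * ((1 - (U + y)) * x - (1 - U) * y) / (r * x * y)
        - (H - (a + t * y)) * ((U + y) * x - U * y) / (r * x * y)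
        + t * ((1 - (U + y)) / r + U / (k + 1)) := by
    have : U / ((k : ℝ) + 1) = U * y / (r * x) := by
      rw [← e]; field_simp
    rw [this]
    field_simp
    ring
  rw [hsplit]
  have t1 : a * ((1 - (U + y)) * x - (1 - U) * y) / (r * x * y) ≤ 0 :=
    div_nonpos_of_nonpos_of_nonneg (mul_nonpos_of_nonneg_of_nonpos ha (by linarith))
      (by positivity)
  have t2 : 0 ≤ (H - (a + t * y)) * ((U + y) * x - U * y) / (r * x * y) :=
    div_nonneg (mul_nonneg (by linarith) (by linarith)) (by positivity)
  have t3 : t * ((1 - (U + y)) / r + U / (k + 1)) ≤ 1 :=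
    mul_le_one₀ hk1 (by positivity) hTU
  linarith

/-- Replacing `h` by `1 - h` turns the upper bound on increments into a lower bound. -/
lemma steinSolution_one_sub {r : ℝ} (hr : 0 < r) {h : ℕ → ℝ} (h0 : ∀ k, 0 ≤ h k)
    (h1 : ∀ k, h k ≤ 1) (k : ℕ) :
    steinSolution r (fun j => 1 - h j) k = -steinSolution r h k := by
  have hmean : poissonMean r (fun j => 1 - h j) = 1 - poissonMean r h := by
    unfold poissonMean
    simp only [sub_mul, one_mul]
    rw [(hasSum_poissonWeight hr).summable.tsum_sub (summable_mul_poissonWeight hr h0 h1),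
      (hasSum_poissonWeight hr).tsum_eq]
  cases k with
  | zero => simp [steinSolution]
  | succ k =>
    simp only [steinSolution, hmean, sub_mul, one_mul, Finset.sum_sub_distrib]
    ring

lemma abs_steinSolution_sub_le {r : ℝ} (hr : 0 < r) {h : ℕ → ℝ} (h0 : ∀ k, 0 ≤ h k)
    (h1 : ∀ k, h k ≤ 1) (k d : ℕ) :
    |steinSolution r h (k + d + 1) - steinSolution r h (k + 1)| ≤ d := by
  induction d with
  | zero => simp
  | succ d ih =>
    have u := steinSolution_succ_sub_le hr h0 h1 (k + d)
    have l := steinSolution_succ_sub_le hr (h := fun j => 1 - h j)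
      (fun j => by linarith [h1 j]) (fun j => by linarith [h0 j]) (k + d)
    simp only [steinSolution_one_sub hr h0 h1] at l
    have e : k + (d + 1) + 1 = k + d + 2 := by ring
    rw [e]
    rw [abs_le] at ih ⊢
    push_cast
    constructor <;> linarith [ih.1, ih.2]

/-! ### The Chen–Stein bound -/

/-- **Chen–Stein bound** for a sum of locally dependent indicators on a finite probability
space with weights `w`: the indicator `X i` is independent of the sum of the indicators outside
the neighbourhood `B i` of `i`. -/
theorem chenStein_finite {α ι : Type*} [Fintype α] [DecidableEq ι] (w : α → ℝ)
    (hw : ∀ a, 0 ≤ w a) (I : Finset ι) (X : ι → α → ℕ) (hX : ∀ i a, X i a = 0 ∨ X i a = 1)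
    (B : ι → Finset ι) (hBI : ∀ i ∈ I, B i ⊆ I) (hB : ∀ i ∈ I, i ∈ B i)
    (p : ι → ℝ) (hp : ∀ i, p i = ∑ a, w a * X i a) (hw1 : ∑ a, w a = 1)
    (hind : ∀ i ∈ I, ∀ g : ℕ → ℝ, ∑ a, w a * (X i a * g (∑ j ∈ I \ B i, X j a)) =
      p i * ∑ a, w a * g (∑ j ∈ I \ B i, X j a))
    (hpos : 0 < ∑ i ∈ I, p i) {h : ℕ → ℝ} (h0 : ∀ k, 0 ≤ h k) (h1 : ∀ k, h k ≤ 1) :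
    ∑ a, w a * h (∑ i ∈ I, X i a) - poissonMean (∑ i ∈ I, p i) h ≤
      ∑ i ∈ I, ∑ j ∈ B i, p i * p j +
        ∑ i ∈ I, ∑ j ∈ (B i).erase i, ∑ a, w a * (X i a * X j a) := by
  set r := ∑ i ∈ I, p i with hr
  set f := steinSolution r h
  set W : α → ℕ := fun a => ∑ i ∈ I, X i a with hW
  have hpn : ∀ i, 0 ≤ p i := fun i => by
    rw [hp]; exact Finset.sum_nonneg fun a _ => mul_nonneg (hw a) (by positivity)
  have step : ∑ a, w a * h (W a) - poissonMean r h =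
      ∑ i ∈ I, (p i * ∑ a, w a * f (W a + 1) - ∑ a, w a * (X i a * f (W a))) := by
    have : ∑ a, w a * h (W a) - poissonMean r h =
        ∑ a, w a * (r * f (W a + 1) - W a * f (W a)) := by
      simp only [f, steinSolution_equation hpos, mul_sub, Finset.sum_sub_distrib]
      rw [← Finset.sum_mul, hw1, one_mul]
    rw [this, Finset.sum_sub_distrib, ← Finset.sum_mul, ← hr, Finset.sum_comm, Finset.mul_sum,
      ← Finset.sum_sub_distrib]
    refine Finset.sum_congr rfl fun a _ => ?_
    rw [← Finset.mul_sum, ← Finset.sum_mul]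
    simp only [hW]
    push_cast
    ring
  have hWa : ∀ i ∈ I, ∀ a, W a = ∑ j ∈ I \ B i, X j a + ∑ j ∈ B i, X j a := fun i hi a =>
    (Finset.sum_sdiff (hBI i hi)).symm
  change ∑ a, w a * h (W a) - poissonMean r h ≤ _
  rw [step, ← Finset.sum_add_distrib]
  refine Finset.sum_le_sum fun i hi => ?_
  set V : α → ℕ := fun a => ∑ j ∈ I \ B i, X j a with hV
  have hi' := hind i hi fun v => f (v + 1)
  -- Independence gives `p i * E f(V+1) = E (X i * f(V+1))`; this common value is inserted between
  -- the two terms.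
  have split : p i * ∑ a, w a * f (W a + 1) - ∑ a, w a * (X i a * f (W a)) =
      p i * ∑ a, w a * (f (W a + 1) - f (V a + 1)) +
        ∑ a, w a * (X i a * (f (V a + 1) - f (W a))) := by
    simp only [mul_sub, Finset.sum_sub_distrib] at hi' ⊢
    simp only [hV]
    linarith
  rw [split]
  refine add_le_add ?_ ?_
  · rw [← Finset.mul_sum]
    refine mul_le_mul_of_nonneg_left ?_ (hpn i)
    have : ∑ j ∈ B i, p j = ∑ a, w a * ((∑ j ∈ B i, X j a : ℕ) : ℝ) := by
      push_cast
      simp only [hp, Finset.mul_sum]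
      rw [Finset.sum_comm]
    rw [this]
    refine Finset.sum_le_sum fun a _ => mul_le_mul_of_nonneg_left ?_ (hw a)
    rw [hWa i hi a]
    exact (le_abs_self _).trans (abs_steinSolution_sub_le hpos h0 h1 _ _)
  · rw [Finset.sum_comm]
    refine Finset.sum_le_sum fun a _ => ?_
    rw [← Finset.mul_sum, ← Finset.mul_sum]
    refine mul_le_mul_of_nonneg_left ?_ (hw a)
    rcases hX i a with hx | hx
    · simp [hx]
    · rw [hx, Nat.cast_one, one_mul, one_mul]
      -- On `X i = 1` the indicator of `i` itself supplies the `+ 1` in `f (V + 1)`, so the diagonal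
      -- term drops out.
      have hWe : W a = V a + (∑ j ∈ (B i).erase i, X j a) + 1 := by
        rw [hWa i hi a, ← Finset.sum_erase_add _ _ (hB i hi), hx]
        ring
      rw [hWe, ← Nat.cast_sum]
      refine (le_abs_self _).trans ?_
      rw [abs_sub_comm]
      exact abs_steinSolution_sub_le hpos h0 h1 _ _

/-! ### Reductions and window patterns -/

/-- Both inverses sort the tuple `τ`, and its sorted rearrangement is unique. -/
lemma perm_eq_of_lt_iff {k : ℕ} {τ τ' : Equiv.Perm (Fin k)}
    (h : ∀ a b, τ a < τ b ↔ τ' a < τ' b) : τ = τ' := by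
  have h1 : Monotone (τ ∘ (τ⁻¹ : Equiv.Perm (Fin k))) := fun a b hab => by simpa using hab
  have h2 : Monotone (τ ∘ (τ'⁻¹ : Equiv.Perm (Fin k))) := fun a b hab => by
    simp only [Function.comp_apply]
    rw [← not_lt, h]
    simpa using hab
  have := Tuple.unique_monotone h1 h2
  refine inv_injective (Equiv.ext fun x => ?_)
  exact τ.injective (congrFun this x)

lemma red_lt_red_iff {k n : ℕ} {w : Fin k → Fin n} (hw : Function.Injective w) (a b : Fin k) :
    red w a < red w b ↔ w a < w b := by
  have hmono : StrictMono (w ∘ Tuple.sort w) :=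
    (Tuple.monotone_sort w).strictMono_of_injective (hw.comp (Tuple.sort w).injective)
  have := hmono.lt_iff_lt (a := red w a) (b := red w b)
  simpa [red] using this.symm

lemma red_eq_iff {k n : ℕ} {w : Fin k → Fin n} (hw : Function.Injective w)
    (τ : Equiv.Perm (Fin k)) : red w = τ ↔ ∀ a b, τ a < τ b ↔ w a < w b := by
  constructor
  · rintro rfl a b
    exact red_lt_red_iff hw a b
  · intro h
    exact perm_eq_of_lt_iff fun a b => (red_lt_red_iff hw a b).trans (h a b).symm

lemma red_congr {k n n' : ℕ} {w : Fin k → Fin n} {w' : Fin k → Fin n'}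
    (hw : Function.Injective w) (hw' : Function.Injective w')
    (h : ∀ a b, w a < w b ↔ w' a < w' b) : red w = red w' :=
  (red_eq_iff hw _).2 fun a b => (red_lt_red_iff hw' a b).trans (h a b).symm

/-- Permuting positions acts on patterns by right multiplication, hence simply transitively; this is
the symmetry behind independence. -/
lemma red_comp_perm {k n : ℕ} {w : Fin k → Fin n} (hw : Function.Injective w)
    (π : Equiv.Perm (Fin k)) : red (w ∘ π) = red w * π :=
  (red_eq_iff (hw.comp π.injective) _).2 fun a b => red_lt_red_iff hw (π a) (π b)

/-- The window of `k` consecutive positions of `Fin n` starting at `i`. -/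
def window {n : ℕ} (k i : ℕ) (h : i + k ≤ n) : Fin k ↪ Fin n :=
  ⟨fun a => ⟨i + a, by omega⟩, fun a b hab => by
    simp only [Fin.mk.injEq, Nat.add_left_cancel_iff] at hab
    exact Fin.ext hab⟩

@[simp]
lemma window_val {n k i : ℕ} (h : i + k ≤ n) (a : Fin k) : (window k i h a : ℕ) = i + a := rfl

lemma mem_range_window {n k i : ℕ} (h : i + k ≤ n) (x : Fin n) :
    x ∈ Set.range (window k i h) ↔ i ≤ x ∧ (x : ℕ) < i + k := by
  constructor
  · rintro ⟨a, rfl⟩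
    simp
  · rintro ⟨h1, h2⟩
    exact ⟨⟨x - i, by omega⟩, Fin.ext (by simp; omega)⟩

lemma window_lt_window_iff {n k i : ℕ} (h : i + k ≤ n) (a b : Fin k) :
    window k i h a < window k i h b ↔ a < b := by
  rw [Fin.lt_def, Fin.lt_def, window_val, window_val, Nat.add_lt_add_iff_left]

/-- The pattern of a permutation in a window. -/
def windowPattern {n : ℕ} (k i : ℕ) (h : i + k ≤ n) (σ : Equiv.Perm (Fin n)) :
    Equiv.Perm (Fin k) :=
  red (σ ∘ window k i h)

lemma injective_comp_window {n k i : ℕ} (h : i + k ≤ n) (σ : Equiv.Perm (Fin n)) :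
    Function.Injective (σ ∘ window k i h) :=
  σ.injective.comp (window k i h).injective

lemma occursAt_iff {m n : ℕ} (τ : Equiv.Perm (Fin m)) (σ : Equiv.Perm (Fin n)) (i : ℕ)
    (h : i + m ≤ n) : OccursAt τ σ i ↔ windowPattern m i h σ = τ :=
  ⟨fun ⟨_, e⟩ => e, fun e => ⟨h, e⟩⟩

/-- A permutation of `Fin k` acting on the positions of a window. -/
noncomputable def windowPerm {n : ℕ} (k i : ℕ) (h : i + k ≤ n) (π : Equiv.Perm (Fin k)) :
    Equiv.Perm (Fin n) :=
  π.viaEmbedding (window k i h)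

lemma windowPerm_window {n k i : ℕ} (h : i + k ≤ n) (π : Equiv.Perm (Fin k)) (a : Fin k) :
    windowPerm k i h π (window k i h a) = window k i h (π a) :=
  π.viaEmbedding_apply _ a

lemma windowPerm_of_notMem {n k i : ℕ} (h : i + k ≤ n) (π : Equiv.Perm (Fin k)) {x : Fin n}
    (hx : x ∉ Set.range (window k i h)) : windowPerm k i h π x = x :=
  π.viaEmbedding_apply_of_notMem _ x hx

lemma windowPerm_mem_range_iff {n k i : ℕ} (h : i + k ≤ n) (π : Equiv.Perm (Fin k)) (x : Fin n) :
    windowPerm k i h π x ∈ Set.range (window k i h) ↔ x ∈ Set.range (window k i h) := by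
  by_cases hx : x ∈ Set.range (window k i h)
  · obtain ⟨a, rfl⟩ := hx
    simp [windowPerm_window]
  · rw [windowPerm_of_notMem h π hx]

lemma windowPattern_mul_windowPerm {n k i : ℕ} (h : i + k ≤ n) (σ : Equiv.Perm (Fin n))
    (π : Equiv.Perm (Fin k)) :
    windowPattern k i h (σ * windowPerm k i h π) = windowPattern k i h σ * π := by
  unfold windowPattern
  rw [← red_comp_perm (injective_comp_window h σ)]
  congr 1
  funext a
  simp [windowPerm_window]

lemma windowPattern_mul_windowPerm_of_disjoint {n k i l j : ℕ} (h : i + k ≤ n) (h' : j + l ≤ n)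
    (hd : i + k ≤ j ∨ j + l ≤ i) (σ : Equiv.Perm (Fin n)) (π : Equiv.Perm (Fin k)) :
    windowPattern l j h' (σ * windowPerm k i h π) = windowPattern l j h' σ := by
  unfold windowPattern
  congr 1
  funext a
  simp only [Function.comp_apply, Equiv.Perm.mul_apply]
  rw [windowPerm_of_notMem]
  rw [mem_range_window, window_val]
  omega

/-! ### Inversions inside and across a window -/

open Classical in
/-- The inversions of a permutation that are not inside a window. -/
noncomputable def crossInversions {n : ℕ} (k i : ℕ) (h : i + k ≤ n) (σ : Equiv.Perm (Fin n)) :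
    Finset (Fin n × Fin n) :=
  (inversions σ).filter fun x =>
    ¬(x.1 ∈ Set.range (window k i h) ∧ x.2 ∈ Set.range (window k i h))

lemma mem_inversions {n : ℕ} (σ : Equiv.Perm (Fin n)) (x : Fin n × Fin n) :
    x ∈ inversions σ ↔ x.1 < x.2 ∧ σ x.2 < σ x.1 := by
  simp [inversions]

/-- Inversions with both positions in the window correspond to inversions of its pattern. This
factors the Mallows weight. -/
lemma card_inversions_eq {n k i : ℕ} (h : i + k ≤ n) (σ : Equiv.Perm (Fin n)) :
    (inversions σ).card =
      (inversions (windowPattern k i h σ)).card + (crossInversions k i h σ).card := by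
  classical
  unfold crossInversions
  rw [← Finset.card_filter_add_card_filter_not (s := inversions σ) (fun x =>
    x.1 ∈ Set.range (window k i h) ∧ x.2 ∈ Set.range (window k i h))]
  congr 1
  symm
  refine Finset.card_bij (fun x _ => (window k i h x.1, window k i h x.2)) ?_ ?_ ?_
  · rintro ⟨a, b⟩ hab
    simp only [inversions, Finset.mem_filter, Finset.mem_univ, true_and, windowPattern,
      red_lt_red_iff (injective_comp_window h σ)] at hab
    simpa [inversions, window_lt_window_iff] using hab
  · rintro ⟨a, b⟩ _ ⟨c, d⟩ _ e
    simpa using e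
  · rintro ⟨x, y⟩ hxy
    simp only [Finset.mem_filter] at hxy
    obtain ⟨hxy, ⟨a, rfl⟩, ⟨b, rfl⟩⟩ := hxy
    refine ⟨(a, b), ?_, rfl⟩
    simp only [inversions, Finset.mem_filter, Finset.mem_univ, true_and, windowPattern,
      red_lt_red_iff (injective_comp_window h σ)]
    simpa [inversions, window_lt_window_iff] using hxy

/-- A window is an interval, so an outside position is fixed and lies on the same side of every
position in the window. -/
lemma windowPerm_lt_windowPerm_iff {n k i : ℕ} (h : i + k ≤ n) (π : Equiv.Perm (Fin k))
    {x y : Fin n} (hxy : ¬(x ∈ Set.range (window k i h) ∧ y ∈ Set.range (window k i h))) :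
    windowPerm k i h π x < windowPerm k i h π y ↔ x < y := by
  have hx := windowPerm_mem_range_iff h π x
  have hy := windowPerm_mem_range_iff h π y
  have hx' := windowPerm_of_notMem h π (x := x)
  have hy' := windowPerm_of_notMem h π (x := y)
  simp only [mem_range_window] at *
  rw [Fin.lt_def, Fin.lt_def]
  by_cases h1 : i ≤ x ∧ (x : ℕ) < i + k
  · have h2 : ¬(i ≤ y ∧ (y : ℕ) < i + k) := fun h2 => hxy ⟨h1, h2⟩
    have h3 := hx.2 h1
    rw [hy' h2]
    omega
  · rw [hx' h1]
    by_cases h2 : i ≤ y ∧ (y : ℕ) < i + k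
    · have h3 := hy.2 h2
      omega
    · rw [hy' h2]

lemma card_crossInversions_mul_windowPerm {n k i : ℕ} (h : i + k ≤ n) (σ : Equiv.Perm (Fin n))
    (π : Equiv.Perm (Fin k)) :
    (crossInversions k i h (σ * windowPerm k i h π)).card = (crossInversions k i h σ).card := by
  classical
  refine Finset.card_equiv ((windowPerm k i h π).prodCongr (windowPerm k i h π)) ?_
  rintro ⟨x, y⟩
  simp only [crossInversions, mem_inversions, Finset.mem_filter,
    Equiv.prodCongr_apply, Prod.map, windowPerm_mem_range_iff, Equiv.Perm.mul_apply]
  refine and_congr_left fun hxy => ?_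
  rw [windowPerm_lt_windowPerm_iff h π hxy]

/-- The generating function of inversions over the symmetric group. -/
lemma sum_pow_card_inversions (n : ℕ) (q : ℝ) :
    ∑ σ : Equiv.Perm (Fin n), q ^ (inversions σ).card = inversionPoly n q := by
  induction n with
  | zero => simp [inversionPoly, inversions]
  | succ n ih =>
    -- `Φ (p, τ)` starts with the letter `p` and continues with `τ` relabelled to skip `p`. The
    -- first letter contributes `p` inversions.
    let Φ : Fin (n + 1) × Equiv.Perm (Fin n) → Equiv.Perm (Fin (n + 1)) := fun x =>
      x.1.cycleRange⁻¹ * Equiv.Perm.decomposeFin.symm (0, x.2)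
    have hΦ0 : ∀ x, Φ x 0 = x.1 := fun x => by
      change x.1.cycleRange.symm (Equiv.Perm.decomposeFin.symm (0, x.2) 0) = _
      rw [Equiv.Perm.decomposeFin_symm_apply_zero, Fin.cycleRange_symm_zero]
    have hΦs : ∀ x j, Φ x (Fin.succ j) = x.1.succAbove (x.2 j) := fun x j => by
      simp [Φ]
    have hinj : Function.Injective Φ := by
      rintro ⟨p, τ⟩ ⟨p', τ'⟩ e
      have hp : p = p' := by
        have := hΦ0 (p, τ)
        rwa [e, hΦ0, eq_comm] at this
      subst hp
      congr 1
      ext j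
      have := hΦs (p, τ) j
      rw [e, hΦs] at this
      exact congrArg _ (Fin.succAbove_right_injective this).symm
    have hbij : Function.Bijective Φ :=
      (Fintype.bijective_iff_injective_and_card Φ).2 ⟨hinj, by
        simp [Fintype.card_perm, Nat.factorial_succ]⟩
    have hinv : ∀ x, (inversions (Φ x)).card = x.1 + (inversions x.2).card := by
      rintro ⟨p, τ⟩
      have card_eq : ∀ {N : ℕ} (ρ : Equiv.Perm (Fin N)),
          (inversions ρ).card = ∑ a, ∑ b, if a < b ∧ ρ b < ρ a then 1 else 0 := fun ρ => by
        rw [inversions, Finset.card_filter, ← Finset.univ_product_univ, Finset.sum_product]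
      rw [card_eq, card_eq, Fin.sum_univ_succ]
      simp only [Fin.sum_univ_succ, hΦ0, hΦs, lt_irrefl, false_and, if_false, zero_add,
        Fin.succ_pos, true_and, Fin.not_lt_zero, Fin.succ_lt_succ_iff,
        Fin.succAbove_lt_succAbove_iff]
      congr 1
      rw [Equiv.sum_comp τ fun j => if p.succAbove j < p then 1 else 0]
      simp only [Fin.succAbove_lt_iff_castSucc_lt]
      simp only [Fin.lt_def, Fin.val_castSucc]
      rw [Fin.sum_univ_eq_sum_range (fun j => if j < (p : ℕ) then 1 else 0) n,
        ← Finset.card_filter]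
      have : (Finset.range n).filter (fun j => j < (p : ℕ)) = Finset.range p := by
        ext j
        simp
        omega
      rw [this, Finset.card_range]
    rw [← hbij.sum_comp, Fintype.sum_prod_type]
    simp only [hinv, pow_add]
    rw [inversionPoly, Finset.prod_Icc_succ_top (by omega), ← inversionPoly, ← ih, mul_comm,
      Finset.sum_mul_sum, ← Fin.sum_univ_eq_sum_range]

lemma inversionPoly_pos (n : ℕ) {q : ℝ} (hq : 0 < q) : 0 < inversionPoly n q := by
  rw [← sum_pow_card_inversions]
  exact Finset.sum_pos (fun σ _ => by positivity) Finset.univ_nonempty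

/-! ### Independence and the law of a window pattern -/

open Classical in
/-- Under the Mallows weights, the pattern in a window of length `k` is independent of every
function that is invariant under permutations of the positions in the window, and it has the
Mallows distribution. -/
lemma sum_mallows_windowPattern {n k i : ℕ} (h : i + k ≤ n) {q : ℝ} (hq : 0 < q)
    (g : Equiv.Perm (Fin n) → ℝ) (hg : ∀ σ π, g (σ * windowPerm k i h π) = g σ)
    (τ : Equiv.Perm (Fin k)) :
    ∑ σ, mallowsWeight q σ * ((if windowPattern k i h σ = τ then 1 else 0) * g σ) =
      mallowsWeight q τ * ∑ σ, mallowsWeight q σ * g σ := by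
  -- `c ρ` is the weight of the fibre over `ρ` without the factor `q ^ inv ρ`. Right multiplication
  -- by `windowPerm k i h ρ` carries the fibre over `1` onto it, so `c` is constant.
  set c : Equiv.Perm (Fin k) → ℝ := fun ρ =>
    ∑ σ, if windowPattern k i h σ = ρ then q ^ (crossInversions k i h σ).card * g σ else 0
    with hc
  have hc1 : ∀ ρ, c ρ = c 1 := fun ρ => by
    simp only [hc]
    rw [← Equiv.sum_comp (Equiv.mulRight (windowPerm k i h ρ))]
    refine Finset.sum_congr rfl fun σ _ => ?_
    simp only [Equiv.coe_mulRight, windowPattern_mul_windowPerm,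
      card_crossInversions_mul_windowPerm, hg, mul_eq_right]
  have hsum : ∀ ρ, ∑ σ, mallowsWeight q σ * ((if windowPattern k i h σ = ρ then 1 else 0) * g σ) =
      q ^ (inversions ρ).card * c 1 / inversionPoly n q := fun ρ => by
    rw [← hc1 ρ, Finset.mul_sum, Finset.sum_div]
    refine Finset.sum_congr rfl fun σ _ => ?_
    split_ifs with hσ
    · rw [mallowsWeight, card_inversions_eq h σ, hσ, pow_add]
      ring
    · simp
  have htot : ∑ σ, mallowsWeight q σ * g σ = inversionPoly k q * c 1 / inversionPoly n q := by
    rw [← sum_pow_card_inversions k, Finset.sum_mul, Finset.sum_div]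
    simp only [← hsum]
    rw [Finset.sum_comm]
    refine Finset.sum_congr rfl fun σ _ => ?_
    rw [← Finset.mul_sum, ← Finset.sum_mul]
    simp
  rw [hsum, htot, mallowsWeight]
  have := inversionPoly_pos k hq
  field_simp

lemma windowPattern_windowPattern {n k i m d : ℕ} (h : i + k ≤ n) (h' : d + m ≤ k)
    (h'' : i + d + m ≤ n) (σ : Equiv.Perm (Fin n)) :
    windowPattern m d h' (windowPattern k i h σ) = windowPattern m (i + d) h'' σ := by
  refine red_congr (injective_comp_window h' _) (injective_comp_window h'' _) fun a b => ?_
  have e : ∀ a, window k i h (window m d h' a) = window m (i + d) h'' a := fun a =>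
    Fin.ext (by simp [add_assoc])
  have := red_lt_red_iff (injective_comp_window h σ) (window m d h' a) (window m d h' b)
  simpa only [windowPattern, Function.comp_apply, e] using this

lemma occursAt_and_occursAt_iff {m n s i : ℕ} (hs : s ≤ m) (h : i + (2 * m - s) ≤ n)
    (τ : Equiv.Perm (Fin m)) (σ : Equiv.Perm (Fin n)) :
    OccursAt τ σ i ∧ OccursAt τ σ (i + (m - s)) ↔
      windowPattern (2 * m - s) i h σ ∈ sequentialOverlaps s τ := by
  simp only [sequentialOverlaps, Finset.mem_filter, Finset.mem_univ, true_and]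
  rw [occursAt_iff τ σ i (by omega), occursAt_iff τ σ (i + (m - s)) (by omega),
    occursAt_iff τ _ 0 (by omega), occursAt_iff τ _ (m - s) (by omega),
    windowPattern_windowPattern h _ (by omega), windowPattern_windowPattern h _ (by omega)]
  simp only [add_zero]

open Classical in
/-- The indicator of an occurrence of `τ` at position `i`. -/
noncomputable def occurrence {m n : ℕ} (τ : Equiv.Perm (Fin m)) (i : ℕ)
    (σ : Equiv.Perm (Fin n)) : ℕ :=
  if OccursAt τ σ i then 1 else 0

lemma sum_mallowsWeight (n : ℕ) {q : ℝ} (hq : 0 < q) :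
    ∑ σ : Equiv.Perm (Fin n), mallowsWeight q σ = 1 := by
  simp only [mallowsWeight, ← Finset.sum_div]
  rw [sum_pow_card_inversions, div_self (inversionPoly_pos n hq).ne']

lemma mallowsWeight_nonneg {n : ℕ} {q : ℝ} (hq : 0 < q) (σ : Equiv.Perm (Fin n)) :
    0 ≤ mallowsWeight q σ :=
  div_nonneg (by positivity) (inversionPoly_pos n hq).le

lemma sum_mallows_occurrence_mul {n m i : ℕ} (h : i + m ≤ n) {q : ℝ} (hq : 0 < q)
    (τ : Equiv.Perm (Fin m)) (g : Equiv.Perm (Fin n) → ℝ)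
    (hg : ∀ σ π, g (σ * windowPerm m i h π) = g σ) :
    ∑ σ, mallowsWeight q σ * (occurrence τ i σ * g σ) =
      mallowsWeight q τ * ∑ σ, mallowsWeight q σ * g σ := by
  classical
  rw [← sum_mallows_windowPattern h hq g hg τ]
  simp only [occurrence, occursAt_iff τ _ i h, Nat.cast_ite, Nat.cast_one, Nat.cast_zero]

lemma sum_mallows_occurrence {n m i : ℕ} (h : i + m ≤ n) {q : ℝ} (hq : 0 < q)
    (τ : Equiv.Perm (Fin m)) :
    ∑ σ : Equiv.Perm (Fin n), mallowsWeight q σ * occurrence τ i σ = mallowsWeight q τ := by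
  simpa [sum_mallowsWeight n hq] using
    sum_mallows_occurrence_mul h hq τ (fun _ => 1) fun _ _ => rfl

lemma occurrence_mul_windowPerm_of_disjoint {n m i j : ℕ} (h : i + m ≤ n) (h' : j + m ≤ n)
    (hd : i + m ≤ j ∨ j + m ≤ i) (τ : Equiv.Perm (Fin m)) (σ : Equiv.Perm (Fin n))
    (π : Equiv.Perm (Fin m)) :
    occurrence τ j (σ * windowPerm m i h π) = occurrence τ j σ := by
  simp only [occurrence, occursAt_iff τ _ j h', windowPattern_mul_windowPerm_of_disjoint h h' hd]

/-- The union of the two windows is a window of length `2m-s`. Its pattern is Mallows distributed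
and decides both occurrences. -/
lemma sum_mallows_overlap {n m s i : ℕ} (hs : s ≤ m) (h : i + (2 * m - s) ≤ n) {q : ℝ}
    (hq : 0 < q) (τ : Equiv.Perm (Fin m)) :
    ∑ σ : Equiv.Perm (Fin n), mallowsWeight q σ *
        ((occurrence τ i σ : ℝ) * occurrence τ (i + (m - s)) σ) =
      ∑ ρ ∈ sequentialOverlaps s τ, mallowsWeight q ρ := by
  classical
  have hρ : ∀ ρ : Equiv.Perm (Fin (2 * m - s)), mallowsWeight q ρ =
      ∑ σ : Equiv.Perm (Fin n), mallowsWeight q σ *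
        if windowPattern (2 * m - s) i h σ = ρ then 1 else 0 := fun ρ => by
    simpa [sum_mallowsWeight n hq] using
      (sum_mallows_windowPattern h hq (fun _ => 1) (fun _ _ => rfl) ρ).symm
  rw [Finset.sum_congr rfl fun ρ _ => hρ ρ, Finset.sum_comm]
  refine Finset.sum_congr rfl fun σ _ => ?_
  rw [← Finset.mul_sum, Finset.sum_ite_eq, ← Nat.cast_mul]
  congr 1
  simp only [← occursAt_and_occursAt_iff hs h τ σ, occurrence, ite_and]
  split_ifs <;> simp

/-! ### Counting overlapping windows -/

/-- The windows of length `m` among the first `N` that meet the window at `i`. -/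
def nearby (N m i : ℕ) : Finset ℕ := (Finset.range N).filter fun j => j < i + m ∧ i < j + m

/-- A symmetric sum over pairs of distinct overlapping windows, grouped by the size `s` of the
overlap. -/
lemma sum_nearby_erase {N m : ℕ} (e : ℕ → ℕ → ℝ) (he : ∀ i j, e i j = e j i) (O : ℕ → ℝ)
    (hO : ∀ s ∈ Finset.Icc 1 (m - 1), ∀ i, i + (m - s) < N → e i (i + (m - s)) = O s) :
    ∑ i ∈ Finset.range N, ∑ j ∈ (nearby N m i).erase i, e i j =
      2 * ∑ s ∈ Finset.Icc 1 (m - 1), ((N - (m - s) : ℕ) : ℝ) * O s := by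
  have hupper : ∑ i ∈ Finset.range N, ∑ j ∈ Finset.range N,
      (if i < j ∧ j < i + m then e i j else 0) =
      ∑ s ∈ Finset.Icc 1 (m - 1), ((N - (m - s) : ℕ) : ℝ) * O s := by
    have hrow : ∀ i ∈ Finset.range N,
        ∑ j ∈ Finset.range N, (if i < j ∧ j < i + m then e i j else 0) =
        ∑ s ∈ Finset.Icc 1 (m - 1), if i < N - (m - s) then O s else 0 := fun i _ => by
      rw [← Finset.sum_filter, ← Finset.sum_filter]
      -- Windows at distance `j - i` share `s = m - (j - i)` positions.
      refine Finset.sum_nbij' (fun j => m - (j - i)) (fun s => i + (m - s)) ?_ ?_ ?_ ?_ ?_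
      · intro j hj
        simp only [Finset.mem_filter, Finset.mem_range, Finset.mem_Icc] at hj ⊢
        omega
      · intro s hs
        simp only [Finset.mem_filter, Finset.mem_range, Finset.mem_Icc] at hs ⊢
        omega
      · intro j hj
        simp only [Finset.mem_filter, Finset.mem_range] at hj
        omega
      · intro s hs
        simp only [Finset.mem_filter, Finset.mem_Icc] at hs
        omega
      · intro j hj
        simp only [Finset.mem_filter, Finset.mem_range] at hj
        have e1 : i + (m - (m - (j - i))) = j := by omega
        rw [← hO (m - (j - i)) (by simp only [Finset.mem_Icc]; omega) i (by omega), e1]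
    rw [Finset.sum_congr rfl hrow, Finset.sum_comm]
    refine Finset.sum_congr rfl fun s _ => ?_
    rw [← Finset.sum_filter, Finset.sum_const, nsmul_eq_mul]
    congr 2
    have : (Finset.range N).filter (fun i => i < N - (m - s)) = Finset.range (N - (m - s)) := by
      ext i
      simp only [Finset.mem_filter, Finset.mem_range]
      omega
    rw [this, Finset.card_range]
  have hlower : ∑ i ∈ Finset.range N, ∑ j ∈ Finset.range N,
      (if j < i ∧ i < j + m then e i j else 0) =
      ∑ i ∈ Finset.range N, ∑ j ∈ Finset.range N, (if i < j ∧ j < i + m then e i j else 0) := by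
    rw [Finset.sum_comm]
    simp only [he]
  rw [two_mul, ← hupper]
  nth_rewrite 1 [← hlower]
  rw [← Finset.sum_add_distrib]
  refine Finset.sum_congr rfl fun i hi => ?_
  rw [← Finset.sum_add_distrib]
  have hset : (nearby N m i).erase i = (Finset.range N).filter
      fun j => (j < i ∧ i < j + m) ∨ (i < j ∧ j < i + m) := by
    ext j
    simp only [nearby, Finset.mem_erase, Finset.mem_filter, Finset.mem_range]
    omega
  rw [hset, Finset.sum_filter]
  refine Finset.sum_congr rfl fun j _ => ?_
  by_cases h1 : j < i ∧ i < j + m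
  · have h2 : ¬(i < j ∧ j < i + m) := by omega
    simp [h1, h2]
  · simp [h1]

/-- For `n ≥ 2m-1` the exact count is `(2m-1)n - 3m² + 4m - 1`. It exceeds `nOne n m` when `n <
3m-1`, so the factor 2 is needed here. -/
lemma sum_card_nearby_le {n m : ℕ} (hm : 2 ≤ m) (hmn : m ≤ n) :
    ∑ i ∈ Finset.range (n - m + 1), ((nearby (n - m + 1) m i).card : ℝ) ≤ 2 * nOne n m := by
  set N := n - m + 1 with hN
  have hNr : (N : ℝ) = n - m + 1 := by rw [hN]; push_cast [Nat.cast_sub hmn]; ring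
  unfold nOne
  split_ifs with hc
  · have h1 : ∑ i ∈ Finset.range N, ((nearby N m i).card : ℝ) =
        N + ∑ i ∈ Finset.range N, ∑ j ∈ (nearby N m i).erase i, (1 : ℝ) := by
      have : (N : ℝ) = ∑ i ∈ Finset.range N, (1 : ℝ) := by simp
      rw [this, ← Finset.sum_add_distrib]
      refine Finset.sum_congr rfl fun i hi => ?_
      have hmem : i ∈ nearby N m i := by
        simp only [nearby, Finset.mem_filter]
        exact ⟨hi, by omega, by omega⟩
      rw [← Finset.card_erase_add_one hmem]
      simp [add_comm]
    have h2 : ∀ k : ℕ, ∑ s ∈ Finset.Icc 1 k, ((N : ℝ) - m + s) =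
        k * ((N : ℝ) - m) + k * (k + 1) / 2 := fun k => by
      induction k with
      | zero => simp
      | succ k ih =>
        rw [Finset.sum_Icc_succ_top (by omega), ih]
        push_cast
        ring
    have h3 : ∑ s ∈ Finset.Icc 1 (m - 1), ((N - (m - s) : ℕ) : ℝ) * 1 =
        ∑ s ∈ Finset.Icc 1 (m - 1), ((N : ℝ) - m + s) := by
      refine Finset.sum_congr rfl fun s hs => ?_
      rw [Finset.mem_Icc] at hs
      rw [Nat.cast_sub (by omega), Nat.cast_sub (by omega)]
      ring
    rw [h1, sum_nearby_erase (fun _ _ => 1) (fun _ _ => rfl) (fun _ => 1) (fun _ _ _ _ => rfl),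
      h3, h2, hNr, Nat.cast_sub (by omega)]
    have hm' : (2 : ℝ) ≤ m := by exact_mod_cast hm
    have hn' : 2 * (m : ℝ) ≤ n + 1 := by exact_mod_cast (by omega : 2 * m ≤ n + 1)
    push_cast
    -- Twice `nOne` minus the count is `(2m+1)(n+1-2m) + m(m-2)`.
    nlinarith [mul_nonneg (by linarith : (0 : ℝ) ≤ 2 * m + 1) (by linarith : (0:ℝ) ≤ n + 1 - 2 * m)]
  · have h1 : ∀ i ∈ Finset.range N, ((nearby N m i).card : ℝ) ≤ N := fun i _ => by
      have := Finset.card_filter_le (Finset.range N) fun j => j < i + m ∧ i < j + m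
      rw [Finset.card_range] at this
      exact_mod_cast this
    have := Finset.sum_le_sum h1
    rw [Finset.sum_const, Finset.card_range, nsmul_eq_mul] at this
    rw [← hNr]
    nlinarith [sq_nonneg (N : ℝ)]

/-! ### Total variation and the bound under Mallows weights -/

lemma sum_mul_comp_eq {α : Type*} [Fintype α] (w : α → ℝ) (W : α → ℕ) (μ : ℕ → ℝ)
    (hμ : ∀ k, μ k = ∑ a, if W a = k then w a else 0) (h : ℕ → ℝ) :
    HasSum (fun k => h k * μ k) (∑ a, w a * h (W a)) := by
  simp only [hμ, Finset.mul_sum]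
  refine hasSum_sum fun a _ => ?_
  convert hasSum_ite_eq (W a) (w a * h (W a)) using 2 with k
  by_cases hk : W a = k
  · simp [hk, mul_comm]
  · simp [hk, Ne.symm hk]

/-- The total variation distance is attained by a test function with values in `[0, 1]`. -/
lemma half_tsum_abs_sub_le {u v : ℕ → ℝ} (hu : HasSum u 1) (hv : HasSum v 1)
    (hu0 : ∀ k, 0 ≤ u k) (hv0 : ∀ k, 0 ≤ v k) {c : ℝ}
    (hc : ∀ h : ℕ → ℝ, (∀ k, 0 ≤ h k) → (∀ k, h k ≤ 1) →
      ∑' k, h k * u k - ∑' k, h k * v k ≤ c) :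
    1 / 2 * ∑' k, |u k - v k| ≤ c := by
  classical
  set h : ℕ → ℝ := fun k => if v k < u k then 1 else 0 with hh
  have h0 : ∀ k, 0 ≤ h k := fun k => by simp only [hh]; split_ifs <;> norm_num
  have h1 : ∀ k, h k ≤ 1 := fun k => by simp only [hh]; split_ifs <;> norm_num
  have su : Summable fun k => h k * u k := hu.summable.of_nonneg_of_le
    (fun k => mul_nonneg (h0 k) (hu0 k)) fun k => mul_le_of_le_one_left (hu0 k) (h1 k)
  have sv : Summable fun k => h k * v k := hv.summable.of_nonneg_of_le
    (fun k => mul_nonneg (h0 k) (hv0 k)) fun k => mul_le_of_le_one_left (hv0 k) (h1 k)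
  -- Summed over `k`, the last bracket vanishes because `u` and `v` have equal total mass.
  have habs : ∀ k, |u k - v k| = 2 * (h k * u k - h k * v k) - (u k - v k) := fun k => by
    simp only [hh]
    split_ifs with hk
    · rw [abs_of_pos (by linarith)]; ring
    · rw [abs_of_nonpos (by linarith)]; ring
  have := ((su.hasSum.sub sv.hasSum).mul_left 2).sub (hu.sub hv)
  simp only [← habs] at this
  rw [this.tsum_eq]
  linarith [hc h h0 h1]

lemma consecutiveOccurrences_eq {m n : ℕ} (τ : Equiv.Perm (Fin m)) (σ : Equiv.Perm (Fin n)) :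
    consecutiveOccurrences τ σ = ∑ i ∈ Finset.range (n - m + 1), occurrence τ i σ := rfl

/-- The mean of the number of consecutive occurrences under the Mallows weights. -/
lemma sum_mallows_consecutiveOccurrences {n m : ℕ} (hmn : m ≤ n) {q : ℝ} (hq : 0 < q)
    (τ : Equiv.Perm (Fin m)) :
    ∑ σ : Equiv.Perm (Fin n), mallowsWeight q σ * consecutiveOccurrences τ σ =
      ((n : ℝ) - m + 1) * mallowsWeight q τ := by
  simp only [consecutiveOccurrences_eq, Nat.cast_sum, Finset.mul_sum]
  rw [Finset.sum_comm, Finset.sum_congr rfl fun i hi => sum_mallows_occurrence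
    (by rw [Finset.mem_range] at hi; omega) hq τ, Finset.sum_const, Finset.card_range, nsmul_eq_mul]
  push_cast [Nat.cast_sub hmn]
  ring

/-- Poisson approximation of the number of consecutive occurrences, for test functions with values
in `[0, 1]`. -/
lemma sum_mallows_comp_consecutiveOccurrences_sub_le {n m : ℕ} (hm : 2 ≤ m) (hmn : m ≤ n) {q : ℝ}
    (hq : 0 < q) (τ : Equiv.Perm (Fin m)) {h : ℕ → ℝ} (h0 : ∀ k, 0 ≤ h k) (h1 : ∀ k, h k ≤ 1) :
    ∑ σ : Equiv.Perm (Fin n), mallowsWeight q σ * h (consecutiveOccurrences τ σ) -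
        poissonMean (((n : ℝ) - m + 1) * mallowsWeight q τ) h ≤ 2 * (bOne n q τ + bTwo n q τ) := by
  set N := n - m + 1 with hN
  set t := mallowsWeight q τ with ht
  have htpos : 0 < t := div_pos (by positivity) (inversionPoly_pos m hq)
  have hp : ∀ i ∈ Finset.range N,
      ∑ σ : Equiv.Perm (Fin n), mallowsWeight q σ * occurrence τ i σ = t := fun i hi =>
    sum_mallows_occurrence (by rw [Finset.mem_range] at hi; omega) hq τ
  have hsub : ∀ i ∈ Finset.range N, nearby N m i ⊆ Finset.range N := fun i _ =>
    Finset.filter_subset _ _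
  have hNr : (N : ℝ) = n - m + 1 := by rw [hN]; push_cast [Nat.cast_sub hmn]; ring
  have hmean : ∑ i ∈ Finset.range N, ∑ σ : Equiv.Perm (Fin n), mallowsWeight q σ *
      occurrence τ i σ = ((n : ℝ) - m + 1) * t := by
    rw [Finset.sum_congr rfl hp, Finset.sum_const, Finset.card_range, nsmul_eq_mul, hNr]
  have key := chenStein_finite (mallowsWeight q) (mallowsWeight_nonneg hq) (Finset.range N)
    (fun i (σ : Equiv.Perm (Fin n)) => occurrence τ i σ)
    (fun i σ => by unfold occurrence; split_ifs <;> simp) (nearby N m) hsub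
    (fun i hi => by
      simp only [nearby, Finset.mem_filter]
      exact ⟨hi, by omega, by omega⟩)
    _ (fun i => rfl) (sum_mallowsWeight n hq)
    (fun i hi g => by
      have him : i + m ≤ n := by rw [Finset.mem_range] at hi; omega
      rw [hp i hi]
      refine sum_mallows_occurrence_mul him hq τ _ fun σ π => ?_
      refine congrArg g (Finset.sum_congr rfl fun j hj => ?_)
      simp only [nearby, Finset.mem_sdiff, Finset.mem_filter, Finset.mem_range] at hj
      exact occurrence_mul_windowPerm_of_disjoint him (by omega) (by omega) τ σ π)
    (by
      rw [hmean, ← hNr, hN]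
      positivity) h0 h1
  rw [hmean] at key
  simp only [← consecutiveOccurrences_eq, hN] at key
  refine key.trans ?_
  rw [← hN]
  have hb1 : ∑ i ∈ Finset.range N, ∑ j ∈ nearby N m i,
      (∑ σ : Equiv.Perm (Fin n), mallowsWeight q σ * occurrence τ i σ) *
        (∑ σ : Equiv.Perm (Fin n), mallowsWeight q σ * occurrence τ j σ) ≤ 2 * bOne n q τ := by
    have : ∀ i ∈ Finset.range N, ∑ j ∈ nearby N m i,
        (∑ σ : Equiv.Perm (Fin n), mallowsWeight q σ * occurrence τ i σ) *
          (∑ σ : Equiv.Perm (Fin n), mallowsWeight q σ * occurrence τ j σ) =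
        (nearby N m i).card * t ^ 2 := fun i hi => by
      rw [Finset.sum_congr rfl fun j hj => by rw [hp i hi, hp j (hsub i hi hj)], Finset.sum_const,
        nsmul_eq_mul, sq]
    rw [Finset.sum_congr rfl this, ← Finset.sum_mul]
    refine (mul_le_mul_of_nonneg_right (sum_card_nearby_le hm hmn) (by positivity)).trans_eq ?_
    rw [bOne, ht, mallowsWeight, div_pow, pow_mul']
    ring
  have hb2 : ∑ i ∈ Finset.range N, ∑ j ∈ (nearby N m i).erase i, ∑ σ : Equiv.Perm (Fin n),
      mallowsWeight q σ * ((occurrence τ i σ : ℝ) * occurrence τ j σ) = 2 * bTwo n q τ := by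
    rw [sum_nearby_erase (fun i j => ∑ σ : Equiv.Perm (Fin n),
      mallowsWeight q σ * ((occurrence τ i σ : ℝ) * occurrence τ j σ))
      (fun i j => by simp only [mul_comm])
      (fun s => ∑ ρ ∈ sequentialOverlaps s τ, mallowsWeight q ρ)
      (fun s hs i hi => by
        rw [Finset.mem_Icc] at hs
        exact sum_mallows_overlap (by omega) (by omega) hq τ), bTwo]
    congr 1
    refine Finset.sum_congr rfl fun s hs => ?_
    rw [Finset.mem_Icc] at hs
    simp only [mallowsWeight]
    congr 1
    -- Since `n - 2m + s + 1 = N - (m - s)`, truncated subtraction agrees with the maximum with 0.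
    rcases le_total (m - s) N with hle | hle
    · rw [Nat.cast_sub hle, Nat.cast_sub (by omega), hNr, max_eq_left]
      · ring
      · have : ((m - s : ℕ) : ℝ) ≤ N := by exact_mod_cast hle
        rw [Nat.cast_sub (by omega), hNr] at this
        linarith
    · rw [Nat.sub_eq_zero_of_le hle, Nat.cast_zero, max_eq_right]
      have : (N : ℝ) ≤ ((m - s : ℕ) : ℝ) := by exact_mod_cast hle
      rw [Nat.cast_sub (by omega), hNr] at this
      linarith
  linarith

/-! ### Transfer to the probability space -/

lemma IsMallows.integral_eq {Ω : Type*} [MeasurableSpace Ω] {P : Measure Ω}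
    [IsProbabilityMeasure P] {n : ℕ} {q : ℝ} (hq : 0 < q) {S : Ω → Equiv.Perm (Fin n)}
    (hS : IsMallows q S P) (F : Equiv.Perm (Fin n) → ℝ) :
    ∫ ω, F (S ω) ∂P = ∑ σ, mallowsWeight q σ * F σ := by
  -- With the discrete σ-algebra, measurability of `S` reduces to that of its fibres, which
  -- `IsMallows` supplies.
  let _ : MeasurableSpace (Equiv.Perm (Fin n)) := ⊤
  have hSm : Measurable S := measurable_to_countable' fun σ => (hS σ).1
  have : IsProbabilityMeasure (P.map S) := Measure.isProbabilityMeasure_map hSm.aemeasurable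
  rw [← integral_map hSm.aemeasurable (f := F) .of_discrete, integral_fintype .of_finite]
  refine Finset.sum_congr rfl fun σ _ => ?_
  rw [measureReal_def, Measure.map_apply hSm trivial, (hS σ).2,
    ENNReal.toReal_ofReal (mallowsWeight_nonneg hq σ), smul_eq_mul]

lemma IsMallows.map_real_singleton {Ω : Type*} [MeasurableSpace Ω] {P : Measure Ω}
    [IsProbabilityMeasure P] {n : ℕ} {q : ℝ} (hq : 0 < q) {S : Ω → Equiv.Perm (Fin n)}
    (hS : IsMallows q S P) (W : Equiv.Perm (Fin n) → ℕ) (k : ℕ) :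
    (P.map fun ω => W (S ω)).real {k} = ∑ σ, if W σ = k then mallowsWeight q σ else 0 := by
  have hWm : Measurable fun ω => W (S ω) := by
    let _ : MeasurableSpace (Equiv.Perm (Fin n)) := ⊤
    exact (measurable_from_top (f := W)).comp (measurable_to_countable' fun σ => (hS σ).1)
  have := hS.integral_eq hq fun σ => if W σ = k then 1 else 0
  simp only [mul_ite, mul_one, mul_zero] at this
  rw [← this, map_measureReal_apply hWm (measurableSet_singleton k),
    ← integral_indicator_one (hWm (measurableSet_singleton k))]
  refine integral_congr_ae (.of_forall fun ω => ?_)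
  by_cases hω : W (S ω) = k <;> simp [hω]

theorem mainTheorem3 {Ω : Type*} [MeasurableSpace Ω] (P : Measure Ω) [IsProbabilityMeasure P]
    (n m : ℕ) (hm : 2 ≤ m) (hmn : m ≤ n) (q : ℝ) (hq : 0 < q)
    (S : Ω → Equiv.Perm (Fin n)) (hS : IsMallows q S P) (τ : Equiv.Perm (Fin m)) :
    (∫ ω, (consecutiveOccurrences τ (S ω) : ℝ) ∂P
        = ((n : ℝ) - m + 1) * q ^ (inversions τ).card / inversionPoly m q) ∧
      dTV (P.map fun ω => consecutiveOccurrences τ (S ω))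
          (poissonMeasure (∫ ω, (consecutiveOccurrences τ (S ω) : ℝ) ∂P).toNNReal)
        ≤ 2 * (bOne n q τ + bTwo n q τ) := by
  have hmean : ∫ ω, (consecutiveOccurrences τ (S ω) : ℝ) ∂P =
      ((n : ℝ) - m + 1) * mallowsWeight q τ := by
    rw [hS.integral_eq hq fun σ => (consecutiveOccurrences τ σ : ℝ),
      sum_mallows_consecutiveOccurrences hmn hq τ]
  have hpos : 0 < ((n : ℝ) - m + 1) * mallowsWeight q τ := by
    have : (m : ℝ) ≤ n := by exact_mod_cast hmn
    exact mul_pos (by linarith) (div_pos (by positivity) (inversionPoly_pos m hq))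
  refine ⟨by rw [hmean, mallowsWeight, mul_div_assoc], ?_⟩
  rw [hmean, dTV]
  have hu := sum_mul_comp_eq (mallowsWeight q) (consecutiveOccurrences τ) _
    (hS.map_real_singleton hq (consecutiveOccurrences τ))
  have hv : ∀ k, (poissonMeasure (((n : ℝ) - m + 1) * mallowsWeight q τ).toNNReal).real {k} =
      poissonWeight (((n : ℝ) - m + 1) * mallowsWeight q τ) k := fun k => by
    rw [poissonMeasure_real_singleton, Real.coe_toNNReal _ hpos.le, poissonWeight]
  simp only [hv]
  refine half_tsum_abs_sub_le ?_ (hasSum_poissonWeight hpos) (fun k => measureReal_nonneg)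
    (fun k => (poissonWeight_pos hpos k).le) fun h h0 h1 => ?_
  · simpa [sum_mallowsWeight n hq] using hu fun _ => 1
  · rw [(hu h).tsum_eq]
    exact sum_mallows_comp_consecutiveOccurrences_sub_le hm hmn hq τ h0 h1
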